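/- \textbf{Theorem (Stability theorem).} Let $B$ be a (possibly non-unital) $C^*$-algebra and let $A\subseteq B$ be a dense $*$-subalgebra that is a Fréchet algebra in some topology $\tau$ of its own (complete, given by a countable separating family of seminorms, with jointly continuous multiplication). Suppose that (a) $A$ is full in $B$: if $A$ has an identity, every element of $A$ invertible in $B$ is invertible in $A$; if not, every element of the unitization $A_1=\mathbb C\oplus A$ that is invertible in $\mathbb C\oplus B$ ($B$ with a new identity adjoined) is invertible in $A_1$; (b) $A$ is closed under $C^\infty$-functional calculus of self-adjoint elements: $f(a)\in A$ for every $a=a^*\in A$ and every $C^\infty$ function $f:\mathbb R\to\mathbb R$ with $f(0)=0$. Then $Bsr(A)=Bsr(B)$ and $tsr(A)=tsr(B)$. If moreover $\tau$ is given by a submultiplicative norm, then also $acsr(A)=acsr(B)$. For $tsr$ and $acsr$ the algebra $A$ carries the topology induced by the norm of $B$. Here, for an algebra $R$ and $n\ge 1$, $Lg_n(R)$ is the set of $(a_1,\dots,a_n)\in R^n$ with $Ra_1+\dots+Ra_n=R$. All ranks are least positive integers $n$ with the stated property ($\infty$ if there is none). If $R$ has an identity: $Bsr(R)$: for every $(a_1,\dots,a_{n+1})\in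 Lg_{n+1}(R)$ there is $(c_1,\dots,c_n)\in R^n$ with $(a_1+c_1a_{n+1},\dots,a_n+c_na_{n+1})\in Lg_n(R)$. $tsr(R)$: $Lg_n(R)$ is dense in $R^n$. $acsr(R)$: for every $m\ge n$ and every nonempty connected open $V\subseteq R^m$, the set $V\cap Lg_m(R)$ is nonempty and connected. If $R$ has no identity, let $R_1=\mathbb C\oplus R$ be its unitization (with the product topology), let $E_n$ be the set of $a\in R_1^n$ with $a\equiv(1,0,\dots,0)$ modulo $R^n$, and put $Lg_n(R_1,R)=Lg_n(R_1)\cap E_n$. Then $Bsr(R)$ is defined by the condition that for every $(a_1,\dots,a_{n+1})\in Lg_{n+1}(R_1,R)$ there is $(c_1,\dots,c_n)\in R^n$ with $(a_i+c_ia_{n+1})_{i\le n}\in Lg_n(R_1,R)$; $tsr(R)$ by the condition that $Lg_n(R_1,R)$ is dense in $E_n$; and $acsr(R)=acsr(R_1)$. -/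

import Mathlib

namespace StableRank

open Filter Topology

noncomputable section

/-- The smallest positive integer satisfying `P`, or `⊤` if there is none. -/
def leastPositive (P : ℕ → Prop) : ℕ∞ :=
  ⨅ (n : ℕ) (_ : 1 ≤ n ∧ P n), (n : ℕ∞)

section Unital

variable (R : Type*) [NonUnitalRing R]

/-- `R` has a (two-sided) identity element. -/
def HasIdentity : Prop := ∃ e : R, ∀ x : R, e * x = x ∧ x * e = x

variable {R} in
/-- Two-sided invertibility in an algebra that has an identity element `e`. -/
def IsInvertible (a : R) : Prop :=
  ∃ e b : R, (∀ x : R, e * x = x ∧ x * e = x) ∧ a * b = e ∧ b * a = e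

/-- `Lg R n`: the `n`-tuples generating `R` as a left ideal, `R a₁ + ⋯ + R aₙ = R`. -/
def Lg (n : ℕ) : Set (Fin n → R) :=
  {a | ∀ x : R, ∃ c : Fin n → R, ∑ i, c i * a i = x}

/-- The condition `(Bsr)ₙ` for an algebra with identity. -/
def BassCondition (n : ℕ) : Prop :=
  ∀ a ∈ Lg R (n + 1), ∃ c : Fin n → R,
    (fun i : Fin n => a i.castSucc + c i * a (Fin.last n)) ∈ Lg R n

/-- `n` belongs to the absolute connected stable range of `R`
(`IsConnected` includes being nonempty). -/
def InAcsRange [TopologicalSpace R] (n : ℕ) : Prop :=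
  ∀ V : Set (Fin n → R), IsOpen V → IsConnected V → IsConnected (V ∩ Lg R n)

end Unital

section General

variable (A : Type*) [NonUnitalRing A] [Module ℂ A] [IsScalarTower ℂ A A] [SMulCommClass ℂ A A]

/-- The `n`-tuples over the unitization `A₁ = ℂ ⊕ A` congruent to `(1, 0, …, 0)` modulo `A`. -/
def affineTuples (n : ℕ) : Set (Fin n → Unitization ℂ A) :=
  {a | ∀ i, (a i).fst = if (i : ℕ) = 0 then 1 else 0}

/-- `Lgₙ(A₁, A)`. -/
def relLg (n : ℕ) : Set (Fin n → Unitization ℂ A) :=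
  Lg (Unitization ℂ A) n ∩ affineTuples A n

/-- The analogue of `(Bsr)ₙ` for an algebra without identity. -/
def RelBassCondition (n : ℕ) : Prop :=
  ∀ a ∈ relLg A (n + 1), ∃ c : Fin n → A,
    (fun i : Fin n => a i.castSucc + (c i : Unitization ℂ A) * a (Fin.last n)) ∈ relLg A n

/-- The topology of the unitization `A₁ = ℂ ⊕ A`, namely the product topology. -/
abbrev unitizationTopology [TopologicalSpace A] : TopologicalSpace (Unitization ℂ A) :=
  TopologicalSpace.induced (fun z => (z.fst, z.snd)) (inferInstance : TopologicalSpace (ℂ × A))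

/-- `Lgₙ(A₁, A)` is dense in the set of tuples congruent to `(1, 0, …, 0)` modulo `A`. -/
def RelLgDense [TopologicalSpace A] (n : ℕ) : Prop :=
  letI : TopologicalSpace (Unitization ℂ A) := unitizationTopology A
  affineTuples A n ⊆ closure (relLg A n)

open Classical in
/-- The Bass stable rank of a complex algebra, with or without identity. -/
def Bsr : ℕ∞ :=
  if HasIdentity A then leastPositive (BassCondition A) else leastPositive (RelBassCondition A)

open Classical in
/-- The (left) topological stable rank of a complex topological algebra, with or without
identity. -/
def tsr [TopologicalSpace A] : ℕ∞ :=
  if HasIdentity A then leastPositive (fun n => Dense (Lg A n)) else leastPositive (RelLgDense A)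

open Classical in
/-- The absolute connected stable rank of a complex topological algebra; for an algebra without
identity it is that of its unitization. -/
def acsr [TopologicalSpace A] : ℕ∞ :=
  if HasIdentity A then leastPositive (fun n => ∀ m ≥ n, InAcsRange A m)
  else
    letI : TopologicalSpace (Unitization ℂ A) := unitizationTopology A
    leastPositive (fun n => ∀ m ≥ n, InAcsRange (Unitization ℂ A) m)

end General

section Topologies

variable {A : Type*} [NonUnitalRing A] [Module ℂ A]

/-- `τ` makes the complex algebra `A` a Fréchet algebra: `τ` is given by a countable separating
family of seminorms, `A` is (sequentially) complete, and multiplication is jointly continuous. -/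
def IsFrechetAlgebra (τ : TopologicalSpace A) : Prop :=
  (∃ p : ℕ → Seminorm ℂ A, WithSeminorms p ∧
    (∀ x : A, (∀ k, p k x = 0) → x = 0) ∧
    ∀ u : ℕ → A,
      (∀ k, ∀ ε > (0 : ℝ), ∃ N, ∀ m ≥ N, ∀ l ≥ N, p k (u m - u l) < ε) →
      ∃ x, Tendsto u atTop (𝓝 x)) ∧
  Continuous (fun z : A × A => z.1 * z.2)

/-- The topology `τ` is given by a submultiplicative norm. -/
def IsNormedAlgebraTopology (τ : TopologicalSpace A) : Prop :=
  ∃ p : Seminorm ℂ A, WithSeminorms (fun _ : Unit => p) ∧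
    (∀ x : A, p x = 0 → x = 0) ∧ ∀ x y : A, p (x * y) ≤ p x * p y

end Topologies

section Subalgebras

variable {B : Type*} [NonUnitalCStarAlgebra B]

/-- Spectral invariance. If `A` has an identity: an element of `A` that is invertible in `B` is
invertible in `A`. Otherwise: an element of the unitization of `A` that is invertible in `B` with
a new identity adjoined is invertible in the unitization of `A`. -/
def IsFull (A : NonUnitalStarSubalgebra ℂ B) : Prop :=
  (HasIdentity A → ∀ a : A, IsInvertible (a : B) → IsInvertible a) ∧
  (¬ HasIdentity A → ∀ z : Unitization ℂ A,
    IsUnit (Unitization.starMap (NonUnitalStarSubalgebraClass.subtype A) z) → IsUnit z)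

/-- Closure under `C^∞`-functional calculus of self-adjoint elements. The functions are taken to
vanish at `0`, so that `f(a)` makes sense in an algebra without identity; if `A` has an identity,
adding a constant to `f` adds a multiple of it to `f(a)`. -/
def IsClosedUnderSmoothCalculus (A : NonUnitalStarSubalgebra ℂ B) : Prop :=
  ∀ a ∈ A, IsSelfAdjoint a → ∀ f : ℝ → ℝ, ContDiff ℝ (⊤ : ℕ∞) f → f 0 = 0 → cfcₙ f a ∈ A

end Subalgebras

end

end StableRank

namespace StableRank

open Filter Topology

/-! ### Unimodular tuples over a ring with identity, absolute and relative to a subset. -/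

section Tuples

/-! Fullness makes unimodularity over A and over B agree: coefficients of a left inverse over B are
approximated from A, the resulting sum stays invertible in B, hence is invertible in A
(`mem_Lg_iff_comp`). Smooth calculus turns an approximation of an identity of B into a projection in
A that must equal it, so A and B fall under the same clause of each definition (`hasIdentity_iff`).

For `tsr` and `acsr` the rest is topology: the unimodular tuples over A are the trace of an open set
on a dense convex subset. Density passes both ways, and so does connectedness, since a dense convex
set meets every ball in a connected set (`IsPreconnected.inter_dense_convex`).

For `Bsr`, approximation alone does not lift the condition from A to B: corrections found for
approximating tuples need not stay bounded. The proof detours through density. Let S be the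
unitization of B, J the copy of B in S, and consider tuples congruent to (1,0,…,0); an identity e of
B is absorbed by adding 1 - e to the first entry. Then Bass for A ⇒ density for A ⇒ density for J ⇒
Bass for J ⇒ Bass for A. The first arrow is the smooth-calculus argument
`LgDenseMod.of_bassConditionMod`, the third is `BassConditionMod.of_lgDenseMod`, and the other two
are approximation. -/

theorem mem_Lg_iff_exists_eq {R : Type*} [NonUnitalRing R] {e : R}
    (he : ∀ x : R, e * x = x ∧ x * e = x) {n : ℕ} {a : Fin n → R} :
    a ∈ Lg R n ↔ ∃ c : Fin n → R, ∑ i, c i * a i = e := by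
  refine ⟨fun h => h e, ?_⟩
  rintro ⟨c, hc⟩ x
  refine ⟨fun i => x * c i, ?_⟩
  simp only [mul_assoc, ← Finset.mul_sum, hc, (he x).2]

theorem mem_Lg_iff_exists_eq_one {S : Type*} [Ring S] {n : ℕ} {a : Fin n → S} :
    a ∈ Lg S n ↔ ∃ c : Fin n → S, ∑ i, c i * a i = 1 :=
  mem_Lg_iff_exists_eq fun x => ⟨one_mul x, mul_one x⟩

theorem mem_Lg_of_isUnit {S : Type*} [Ring S] {n : ℕ} {a : Fin n → S} (c : Fin n → S)
    (h : IsUnit (∑ i, c i * a i)) : a ∈ Lg S n := by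
  obtain ⟨u, hu⟩ := h
  refine mem_Lg_iff_exists_eq_one.2 ⟨fun i => ↑u⁻¹ * c i, ?_⟩
  simp only [mul_assoc, ← Finset.mul_sum, ← hu, Units.inv_mul]

theorem isOpen_Lg (S : Type*) [NormedRing S] [CompleteSpace S] (n : ℕ) : IsOpen (Lg S n) := by
  refine isOpen_iff_mem_nhds.2 fun a ha => ?_
  obtain ⟨c, hc⟩ := mem_Lg_iff_exists_eq_one.1 ha
  have hcont : Continuous fun b : Fin n → S => ∑ i, c i * b i := by fun_prop
  refine mem_of_superset ((Units.isOpen.preimage hcont).mem_nhds ?_) fun b hb =>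
    mem_Lg_of_isUnit c hb
  change IsUnit (∑ i, c i * a i)
  rw [hc]
  exact isUnit_one

/-- The tuple `(1, 0, …, 0)`. -/
def firstUnit (S : Type*) [Zero S] [One S] (n : ℕ) (i : Fin n) : S := if (i : ℕ) = 0 then 1 else 0

/-- The tuples congruent to `(1, 0, …, 0)` modulo a set `X`. -/
def tuplesMod {S : Type*} [Ring S] (X : Set S) (n : ℕ) : Set (Fin n → S) :=
  {a | ∀ i, a i - firstUnit S n i ∈ X}

/-- The Bass condition for tuples congruent to `(1, 0, …, 0)` modulo a set `X`. -/
def BassConditionMod {S : Type*} [Ring S] (X : Set S) (n : ℕ) : Prop :=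
  ∀ a ∈ Lg S (n + 1) ∩ tuplesMod X (n + 1), ∃ c : Fin n → S, (∀ i, c i ∈ X) ∧
    (fun i : Fin n => a i.castSucc + c i * a (Fin.last n)) ∈ Lg S n

/-- Density of the unimodular tuples among those congruent to `(1, 0, …, 0)` modulo `X`. -/
def LgDenseMod {S : Type*} [Ring S] [TopologicalSpace S] (X : Set S) (n : ℕ) : Prop :=
  tuplesMod X n ⊆ closure (Lg S n ∩ tuplesMod X n)

theorem last_mem_of_mem_tuplesMod {S : Type*} [Ring S] {X : Set S} {n : ℕ} (hn : 1 ≤ n)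
    {a : Fin (n + 1) → S} (ha : a ∈ tuplesMod X (n + 1)) : a (Fin.last n) ∈ X := by
  have := ha (Fin.last n)
  rwa [firstUnit, if_neg (by simpa using by omega), sub_zero] at this

theorem exists_tuple_sum_eq_one {S : Type*} [Ring S] {X : Set S}
    (hX : ∀ x ∈ X, ∀ s : S, -x * s ∈ X) {n : ℕ} {a : Fin (n + 1) → S}
    (ha : a ∈ Lg S (n + 1) ∩ tuplesMod X (n + 1)) :
    ∃ x ∈ tuplesMod X (n + 1), ∑ i, x i * a i = 1 := by
  obtain ⟨x, hx⟩ := mem_Lg_iff_exists_eq_one.1 ha.1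
  -- The first summand contributes `a 0` and the second `1 - a 0`; the latter factor lies in `X`
  -- because `a 0` is congruent to 1.
  refine ⟨fun i => firstUnit S (n + 1) i + (1 - a 0) * x i, fun i => ?_, ?_⟩
  · have := hX _ (ha.2 0) (x i)
    simpa [firstUnit] using this
  · have h0 : ∑ i, firstUnit S (n + 1) i * a i = a 0 := by
      simp [firstUnit]
    simp only [add_mul, Finset.sum_add_distrib, mul_assoc, ← Finset.mul_sum, hx, h0, mul_one,
      add_sub_cancel]

end Tuples

/-! ### Approximation, and density implies the Bass condition. -/

section Core

variable {S : Type*} [CStarAlgebra S]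

theorem tuplesMod_subset_closure {A J : Set S} (hAJ : J ⊆ closure A) (n : ℕ) :
    tuplesMod J n ⊆ closure (tuplesMod A n) := by
  intro a ha
  rw [Metric.mem_closure_iff]
  intro ε hε
  have (i : Fin n) : ∃ b ∈ A, dist (a i - firstUnit S n i) b < ε :=
    Metric.mem_closure_iff.1 (hAJ (ha i)) ε hε
  choose b hb hd using this
  refine ⟨fun i => b i + firstUnit S n i, fun i => by simpa using hb i, ?_⟩
  rw [dist_pi_lt_iff hε]
  intro i
  have := hd i
  rwa [dist_eq_norm, sub_sub, add_comm, ← dist_eq_norm] at this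

theorem LgDenseMod.of_subset_closure {A J : Set S} (hA : A ⊆ J) (hAJ : J ⊆ closure A) {n : ℕ}
    (h : LgDenseMod A n) : LgDenseMod J n := by
  refine (tuplesMod_subset_closure hAJ n).trans (closure_minimal (h.trans ?_) isClosed_closure)
  exact closure_mono (Set.inter_subset_inter_right _ fun a ha i => hA (ha i))

/-- For a fixed tuple the admissible corrections form an open set, so one with entries in `J` can be
moved into `A`. -/
theorem BassConditionMod.of_subset_closure {A J : Set S} (hA : A ⊆ J) (hAJ : J ⊆ closure A) {n : ℕ}
    (h : BassConditionMod J n) : BassConditionMod A n := by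
  intro a ha
  obtain ⟨c, hc, hac⟩ := h a ⟨ha.1, fun i => hA (ha.2 i)⟩
  have hcl : c ∈ closure {c : Fin n → S | ∀ i, c i ∈ A} := by
    rw [Metric.mem_closure_iff]
    intro ε hε
    choose b hb hd using fun i => Metric.mem_closure_iff.1 (hAJ (hc i)) ε hε
    exact ⟨b, hb, (dist_pi_lt_iff hε).2 hd⟩
  have hcont : Continuous fun c : Fin n → S =>
      fun i : Fin n => a i.castSucc + c i * a (Fin.last n) := by fun_prop
  obtain ⟨c', h1, h2⟩ := mem_closure_iff.1 hcl _ ((isOpen_Lg S n).preimage hcont) hac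
  exact ⟨c', h2, h1⟩

/-- Take a left inverse `x` of `b` that is itself congruent to (1,0,…,0), and perturb its first `n`
entries so that they become right unimodular. The last term `x_{n+1} b_{n+1}` can then be
distributed over the first `n` terms. -/
theorem BassConditionMod.of_lgDenseMod {J : NonUnitalStarSubalgebra ℂ S}
    (hJ : ∀ s : S, ∀ x ∈ J, s * x ∈ J) {n : ℕ} (hn : 1 ≤ n) (h : LgDenseMod (J : Set S) n) :
    BassConditionMod (J : Set S) n := by
  have hJ' : ∀ s : S, ∀ x ∈ J, x * s ∈ J := fun s x hx => by
    have := star_mem (hJ (star s) _ (star_mem hx))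
    simpa using this
  intro b hb
  obtain ⟨x, hx, hxb⟩ := exists_tuple_sum_eq_one
    (fun x hx s => hJ' s _ (neg_mem (show x ∈ J from hx))) hb
  -- Density concerns left unimodular tuples, whereas coefficients must be right unimodular; the
  -- involution exchanges the two.
  have hxs : (fun i : Fin n => star (x i.castSucc)) ∈ tuplesMod (J : Set S) n := fun i => by
    have := star_mem (show _ ∈ J from hx i.castSucc)
    rw [star_sub] at this
    simp only [firstUnit, apply_ite star, star_one, star_zero] at this
    exact this
  let y := x (Fin.last n) * b (Fin.last n)
  have hcont : Continuous fun v : Fin n → S => ∑ i, star (v i) * b i.castSucc + y := by fun_prop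
  have hmem : IsUnit (∑ i : Fin n, star (star (x i.castSucc)) * b i.castSucc + y) := by
    simp only [star_star, y]
    rw [Fin.sum_univ_castSucc] at hxb
    rw [hxb]
    exact isUnit_one
  obtain ⟨v, hv, hvL, hvJ⟩ := mem_closure_iff.1 (h hxs) _ (Units.isOpen.preimage hcont) hmem
  obtain ⟨z, hz⟩ := mem_Lg_iff_exists_eq_one.1 hvL
  have hz' : ∑ i, star (v i) * star (z i) = 1 := by
    have := congrArg star hz
    simpa using this
  refine ⟨fun i => star (z i) * x (Fin.last n), fun i => hJ _ _ ?_,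
    mem_Lg_of_isUnit (fun i => star (v i)) ?_⟩
  · exact last_mem_of_mem_tuplesMod hn hx
  · have hs : ∑ i, star (v i) * (b i.castSucc + star (z i) * x (Fin.last n) * b (Fin.last n)) =
        ∑ i, star (v i) * b i.castSucc + y := by
      simp only [mul_add, Finset.sum_add_distrib, ← mul_assoc, ← Finset.sum_mul, hz', one_mul, y]
    rw [hs]
    exact hv

theorem cfc_mem_of_sub_one_mem {A : NonUnitalStarSubalgebra ℂ S}
    (hA : ∀ k ∈ A, IsSelfAdjoint k → ∀ f : ℝ → ℝ, ContDiff ℝ (⊤ : ℕ∞) f → f 0 = 0 → cfc f k ∈ A)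
    {h : S} (hs : IsSelfAdjoint h) (h1 : h - 1 ∈ A) {f : ℝ → ℝ} (hf : ContDiff ℝ (⊤ : ℕ∞) f)
    (hf1 : f 1 = 0) : cfc f h ∈ A := by
  have hk : IsSelfAdjoint (h - 1) := hs.sub (.one S)
  have := hA _ h1 hk (fun t => f (t + 1)) (hf.comp (contDiff_id.add contDiff_const)) (by simpa)
  have hc := hf.continuous
  rw [cfc_comp' f (fun t => t + 1) (h - 1), cfc_add_const (1 : ℝ) (fun t => t) (h - 1),
    cfc_id' ℝ (h - 1)] at this
  simpa using this

end Core

/-! ### From the Bass condition to density by smooth functional calculus. -/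

section HermanVaserstein

variable {S : Type*} [CStarAlgebra S]

theorem firstUnit_mul_mem {A : NonUnitalStarSubalgebra ℂ S} {x : S} (hx : x ∈ A) {n : ℕ}
    (i : Fin n) : firstUnit S n i * x ∈ A := by
  unfold firstUnit
  split_ifs
  · simpa
  · simp

theorem sum_firstUnit {n : ℕ} (hn : 1 ≤ n) : ∑ i, firstUnit S n i = 1 := by
  obtain ⟨m, rfl⟩ := Nat.exists_eq_add_of_le' hn
  simp [firstUnit]

theorem sum_star_mul_self_sub_one_mem {A : NonUnitalStarSubalgebra ℂ S} {n : ℕ} (hn : 1 ≤ n)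
    {a : Fin n → S} (ha : a ∈ tuplesMod (A : Set S) n) : ∑ i, star (a i) * a i - 1 ∈ A := by
  rw [← sum_firstUnit (S := S) hn, ← Finset.sum_sub_distrib]
  refine sum_mem fun i _ => ?_
  have hx : a i - firstUnit S n i ∈ A := ha i
  have key : star (a i) * a i - firstUnit S n i =
      star (a i - firstUnit S n i) * (a i - firstUnit S n i)
        + firstUnit S n i * (a i - firstUnit S n i)
        + firstUnit S n i * star (a i - firstUnit S n i) := by
    unfold firstUnit
    split_ifs
    · simp only [star_sub, star_one]
      noncomm_ring
    · simp
  rw [key]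
  exact add_mem (add_mem (mul_mem (star_mem hx) hx) (firstUnit_mul_mem hx i))
    (firstUnit_mul_mem (star_mem hx) i)

theorem norm_mul_sq_le_of_sum {n : ℕ} (a : Fin n → S) (y : S) (i : Fin n) :
    ‖a i * y‖ ^ 2 ≤ ‖star y * (∑ i, star (a i) * a i) * y‖ := by
  let _ := CStarAlgebra.spectralOrder S
  have := CStarAlgebra.spectralOrderedRing S
  rw [sq, ← CStarRing.norm_star_mul_self]
  have hle : star (a i) * a i ≤ ∑ i, star (a i) * a i :=
    Finset.single_le_sum (f := fun i => star (a i) * a i)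
      (fun i _ => star_mul_self_nonneg (a i)) (Finset.mem_univ i)
  have := star_left_conjugate_le_conjugate hle y
  refine le_trans (le_of_eq ?_)
    (CStarAlgebra.norm_le_norm_of_nonneg_of_le ?_ this)
  · simp [mul_assoc]
  · exact star_left_conjugate_nonneg (star_mul_self_nonneg _) y

theorem spectrum_sum_star_mul_self_nonneg {n : ℕ} (a : Fin n → S) {t : ℝ}
    (ht : t ∈ spectrum ℝ (∑ i, star (a i) * a i)) : 0 ≤ t := by
  let _ := CStarAlgebra.spectralOrder S
  have := CStarAlgebra.spectralOrderedRing S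
  exact spectrum_nonneg_of_nonneg (Finset.sum_nonneg fun i _ => star_mul_self_nonneg (a i)) ht

theorem exists_contDiff_cutoff {r : ℝ} (hr : 0 < r) : ∃ φ : ℝ → ℝ, ContDiff ℝ (⊤ : ℕ∞) φ ∧
    (∀ t ≤ 0, φ t = 1) ∧ (∀ t, 0 ≤ φ t) ∧ (∀ t, φ t ≤ 1) ∧ ∀ t, r ≤ t → φ t = 0 := by
  refine ⟨fun t => Real.smoothTransition (1 - t / r), Real.smoothTransition.contDiff.comp
    (contDiff_const.sub (contDiff_id.div_const r)), fun t ht => Real.smoothTransition.one_of_one_le ?_,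
    fun t => Real.smoothTransition.nonneg _, fun t => Real.smoothTransition.le_one _,
    fun t ht => Real.smoothTransition.zero_of_nonpos ?_⟩
  · have := div_nonpos_of_nonpos_of_nonneg ht hr.le
    linarith
  · rw [sub_nonpos, one_le_div hr]
    exact ht

theorem exists_contDiff_pos_cutoff {r δ : ℝ} (hr : 0 < r) (hδ : 0 < δ) (hδ1 : δ ≤ 1) :
    ∃ χ : ℝ → ℝ, ContDiff ℝ (⊤ : ℕ∞) χ ∧ (∀ t, 0 < χ t) ∧ (∀ t, χ t ≤ 1) ∧
      (∀ t, t ≤ r → χ t = δ) ∧ ∀ t, 2 * r ≤ t → χ t = 1 := by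
  obtain ⟨φ, hφ, h0, hφ_nonneg, hφ_le, hφ_big⟩ := exists_contDiff_cutoff hr
  refine ⟨fun t => δ + (1 - δ) * φ (2 * r - t), contDiff_const.add (contDiff_const.mul
    (hφ.comp (contDiff_const.sub contDiff_id))), fun t => ?_, fun t => ?_, fun t ht => ?_,
    fun t ht => ?_⟩
  · have := mul_nonneg (sub_nonneg.2 hδ1) (hφ_nonneg (2 * r - t))
    linarith
  · have := mul_le_mul_of_nonneg_left (hφ_le (2 * r - t)) (sub_nonneg.2 hδ1)
    linarith
  · simp [hφ_big (2 * r - t) (by linarith)]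
  · simp [h0 (2 * r - t) (by linarith)]

/-- With `h = ∑ aᵢ* aᵢ ≥ 0` and `φ` a bump near 0, `h + φ(h)` is invertible, so `(a, φ(h))` is
unimodular and the Bass condition yields a unimodular `a + c φ(h)`. As `c` may be large, multiply on
the right by an invertible `k = χ(h)` that is tiny where `φ` lives and 1 away from 0: this shrinks
`c φ(h)` and barely moves `a`, which is itself small where `h` is. -/
theorem LgDenseMod.of_bassConditionMod {A : NonUnitalStarSubalgebra ℂ S}
    (hA : ∀ k ∈ A, IsSelfAdjoint k → ∀ f : ℝ → ℝ, ContDiff ℝ (⊤ : ℕ∞) f → f 0 = 0 → cfc f k ∈ A)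
    {n : ℕ} (hn : 1 ≤ n) (hB : BassConditionMod (A : Set S) n) : LgDenseMod (A : Set S) n := by
  intro a ha
  rw [Metric.mem_closure_iff]
  intro ε hε
  set h : S := ∑ i, star (a i) * a i with hh
  have hsa : IsSelfAdjoint h := isSelfAdjoint_sum _ fun i _ => .star_mul_self (a i)
  have h1 : h - 1 ∈ A := sum_star_mul_self_sub_one_mem hn ha
  have hspec : ∀ t ∈ spectrum ℝ h, 0 ≤ t := fun t ht => spectrum_sum_star_mul_self_nonneg a ht
  -- `2r ≤ 1` gives `φ(1) = 0` and `χ(1) = 1`, which puts `φ(h)` and `k - 1` in `A`; `2r` will bound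
  -- `‖aᵢ(k - 1)‖²`.
  obtain ⟨r, hr, hr1, hrε⟩ : ∃ r : ℝ, 0 < r ∧ 2 * r ≤ 1 ∧ 2 * r < (ε / 2) ^ 2 := by
    refine ⟨min (1 / 2) (ε ^ 2 / 16), by positivity, ?_, ?_⟩
    · linarith [min_le_left (1 / 2 : ℝ) (ε ^ 2 / 16)]
    · nlinarith [min_le_right (1 / 2 : ℝ) (ε ^ 2 / 16)]
  obtain ⟨φ, hφ, hφ0, hφ_nonneg, hφ_le, hφ_big⟩ := exists_contDiff_cutoff hr
  have hφc : Continuous φ := hφ.continuous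
  have hφ1 : φ 1 = 0 := hφ_big 1 (by linarith)
  have hφA : cfc φ h ∈ A := cfc_mem_of_sub_one_mem hA hsa h1 hφ hφ1
  have hφu : IsUnit (h + cfc φ h) := by
    have : h + cfc φ h = cfc (fun t => t + φ t) h := by
      rw [cfc_add h (fun t => t) φ, cfc_id' ℝ h]
    rw [this, isUnit_cfc_iff (fun t => t + φ t) h]
    intro t ht
    have h0 := hspec t ht
    rcases h0.eq_or_lt with rfl | h0
    · simp [hφ0]
    · have := hφ_nonneg t
      positivity
  have hbL : (Fin.snoc a (cfc φ h) : Fin (n + 1) → S) ∈ Lg S (n + 1) := by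
    refine mem_Lg_of_isUnit (Fin.snoc (fun i => star (a i)) 1) ?_
    simpa [Fin.sum_univ_castSucc] using hφu
  have hbA : (Fin.snoc a (cfc φ h) : Fin (n + 1) → S) ∈ tuplesMod (A : Set S) (n + 1) := by
    intro i
    refine Fin.lastCases ?_ (fun i => ?_) i
    · simpa [firstUnit, show n ≠ 0 by omega] using hφA
    · simpa [firstUnit] using ha i
  obtain ⟨c, hc, hcL⟩ := hB _ ⟨hbL, hbA⟩
  simp only [Fin.snoc_castSucc, Fin.snoc_last] at hcL
  -- `δ`, the value of `χ` on the support of `φ`, can depend on `c` because `φ` and `c` are already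
  -- fixed.
  obtain ⟨δ, hδ, hδ1, hδc⟩ : ∃ δ : ℝ, 0 < δ ∧ δ ≤ 1 ∧ ∀ i, ‖c i‖ * δ < ε / 2 := by
    refine ⟨min 1 (ε / (4 * (‖c‖ + 1))), by positivity, min_le_left _ _, fun i => ?_⟩
    calc ‖c i‖ * min 1 (ε / (4 * (‖c‖ + 1))) ≤ (‖c‖ + 1) * (ε / (4 * (‖c‖ + 1))) := by
          gcongr
          · linarith [norm_le_pi_norm c i]
          · exact min_le_right _ _
      _ = ε / 4 := by field_simp
      _ < ε / 2 := by linarith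
  obtain ⟨χ, hχ, hχ_pos, hχ_le, hχ_small, hχ_big⟩ := exists_contDiff_pos_cutoff hr hδ hδ1
  have hχc : Continuous χ := hχ.continuous
  set k : S := cfc χ h with hk
  have hk1 : k - 1 = cfc (fun t => χ t - 1) h := by
    rw [cfc_sub χ (fun _ => 1) h, cfc_const_one ℝ h]
  have hkA : k - 1 ∈ A := by
    rw [hk1]
    refine cfc_mem_of_sub_one_mem hA hsa h1 (hχ.sub contDiff_const) ?_
    rw [hχ_big 1 hr1, sub_self]
  have hku : IsUnit k := (isUnit_cfc_iff χ h).2 fun t _ => (hχ_pos t).ne'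
  have hφk : ‖cfc φ h * k‖ ≤ δ := by
    rw [hk, ← cfc_mul φ χ h]
    refine norm_cfc_le hδ.le fun t _ => ?_
    rcases le_total t r with ht | ht
    · rw [hχ_small t ht, Real.norm_of_nonneg (mul_nonneg (hφ_nonneg t) hδ.le)]
      exact mul_le_of_le_one_left hδ.le (hφ_le t)
    · rw [hφ_big t ht]; simpa using hδ.le
  have hak : ∀ i, ‖a i * (k - 1)‖ < ε / 2 := fun i => by
    have hks : star (k - 1) = k - 1 := by rw [hk1]; exact (IsSelfAdjoint.cfc).star_eq
    have hle := norm_mul_sq_le_of_sum a (k - 1) i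
    have heq : star (k - 1) * h * (k - 1) = cfc (fun t => (χ t - 1) * t * (χ t - 1)) h := by
      rw [hks, hk1, cfc_mul (fun t => (χ t - 1) * t) (fun t => χ t - 1) h,
        cfc_mul (fun t => χ t - 1) (fun t => t) h, cfc_id' ℝ h]
    rw [← hh, heq] at hle
    have hn2 : ‖cfc (fun t => (χ t - 1) * t * (χ t - 1)) h‖ ≤ 2 * r := by
      refine norm_cfc_le (by positivity) fun t ht => ?_
      have h0 := hspec t ht
      have hp := hχ_pos t
      have hl := hχ_le t
      have hsq : (χ t - 1) ^ 2 ≤ 1 := by nlinarith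
      rcases le_total t (2 * r) with h2 | h2
      · rw [show (χ t - 1) * t * (χ t - 1) = (χ t - 1) ^ 2 * t by ring,
          Real.norm_of_nonneg (by positivity)]
        exact (mul_le_of_le_one_left h0 hsq).trans h2
      · rw [hχ_big t h2]; simpa using hr.le
    exact lt_of_pow_lt_pow_left₀ 2 (by positivity) ((hle.trans hn2).trans_lt hrε)
  refine ⟨fun i => (a i + c i * cfc φ h) * k, ⟨?_, fun i => ?_⟩, ?_⟩
  · obtain ⟨z, hz⟩ := mem_Lg_iff_exists_eq_one.1 hcL
    refine mem_Lg_of_isUnit z ?_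
    simp only [← mul_assoc, ← Finset.sum_mul, hz, one_mul]
    exact hku
  · have hx : a i - firstUnit S n i + c i * cfc φ h ∈ A :=
      add_mem (ha i) (mul_mem (hc i) hφA)
    have key : (a i + c i * cfc φ h) * k - firstUnit S n i =
        (a i - firstUnit S n i + c i * cfc φ h) + firstUnit S n i * (k - 1)
        + (a i - firstUnit S n i + c i * cfc φ h) * (k - 1) := by noncomm_ring
    change _ ∈ A
    rw [key]
    exact add_mem (add_mem hx (firstUnit_mul_mem hkA i)) (mul_mem hx hkA)
  · rw [dist_comm, dist_pi_lt_iff hε]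
    intro i
    rw [dist_eq_norm, show (a i + c i * cfc φ h) * k - a i =
      a i * (k - 1) + c i * (cfc φ h * k) by noncomm_ring]
    calc _ ≤ ‖a i * (k - 1)‖ + ‖c i‖ * ‖cfc φ h * k‖ :=
          (norm_add_le _ _).trans (by gcongr; exact norm_mul_le _ _)
      _ ≤ ‖a i * (k - 1)‖ + ‖c i‖ * δ := by gcongr
      _ < ε := by linarith [hak i, hδc i]

/-- A dense smooth subalgebra of an ideal satisfies the same Bass conditions as the ideal. -/
theorem bassConditionMod_iff {A J : NonUnitalStarSubalgebra ℂ S}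
    (hA : ∀ k ∈ A, IsSelfAdjoint k → ∀ f : ℝ → ℝ, ContDiff ℝ (⊤ : ℕ∞) f → f 0 = 0 → cfc f k ∈ A)
    (hJ : ∀ s : S, ∀ x ∈ J, s * x ∈ J) (hAJ : (A : Set S) ⊆ J) (hJA : (J : Set S) ⊆ closure A)
    {n : ℕ} (hn : 1 ≤ n) :
    BassConditionMod (A : Set S) n ↔ BassConditionMod (J : Set S) n :=
  ⟨fun h => .of_lgDenseMod hJ hn (.of_subset_closure hAJ hJA (.of_bassConditionMod hA hn h)),
    .of_subset_closure hAJ hJA⟩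

end HermanVaserstein

/-! ### Density along an inducing map. -/

section Density

theorem subset_closure_preimage_iff {E F : Type*} [TopologicalSpace E] [TopologicalSpace F]
    {ψ : E → F} (hψ : IsInducing ψ) {P G : Set F} (hP : P ⊆ closure (P ∩ Set.range ψ))
    (hG : IsOpen G) : ψ ⁻¹' P ⊆ closure (ψ ⁻¹' (G ∩ P)) ↔ P ⊆ closure (G ∩ P) := by
  constructor
  · intro h y hy
    rw [mem_closure_iff]
    intro O hO hyO
    obtain ⟨_, hxO, hxP, x, rfl⟩ := mem_closure_iff.1 (hP hy) O hO hyO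
    obtain ⟨x', h1, h2⟩ := mem_closure_iff.1 (h hxP) _ (hO.preimage hψ.continuous) hxO
    exact ⟨ψ x', h1, h2⟩
  · intro h x hx
    rw [hψ.closure_eq_preimage_closure_image]
    refine mem_closure_iff.2 fun O hO hxO => ?_
    obtain ⟨y, hyO, hyG, hyP⟩ := mem_closure_iff.1 (h hx) O hO hxO
    obtain ⟨_, ⟨hO', hG'⟩, hP', x', rfl⟩ :=
      mem_closure_iff.1 (hP hyP) _ (hO.inter hG) ⟨hyO, hyG⟩
    exact ⟨ψ x', hO', x', ⟨hG', hP'⟩, rfl⟩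

end Density

/-! ### Connected open sets and dense convex subsets. -/

section Connectedness

variable {F : Type*} [NormedAddCommGroup F] [NormedSpace ℝ F]

/-- If `P` and `Q` separated `U ∩ D`, each ball in `U` would meet `D` in a convex set lying in `P`
or in `Q`. The unions of the balls of each kind are open and cover `U`, so they overlap, and density
puts a point of `D` in both `P` and `Q`. -/
theorem IsPreconnected.inter_dense_convex {U D : Set F} (hU : IsPreconnected U) (hUo : IsOpen U)
    (hD : Dense D) (hDc : Convex ℝ D) : IsPreconnected (U ∩ D) := by
  rintro P Q hP hQ hPQ ⟨p, ⟨hpU, hpD⟩, hpP⟩ ⟨q, ⟨hqU, hqD⟩, hqQ⟩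
  by_contra hne
  rw [Set.not_nonempty_iff_eq_empty] at hne
  let N (P : Set F) : Set F := ⋃ z ∈ {z : F × ℝ | Metric.ball z.1 z.2 ⊆ U ∧
    Metric.ball z.1 z.2 ∩ D ⊆ P}, Metric.ball z.1 z.2
  have hN : ∀ P, IsOpen (N P) := fun P => isOpen_biUnion fun _ _ => Metric.isOpen_ball
  have hball : ∀ x ∈ U, ∃ r > 0, Metric.ball x r ⊆ U := fun x hx => Metric.isOpen_iff.1 hUo x hx
  have hdich : ∀ x r, Metric.ball x r ⊆ U →
      Metric.ball x r ∩ D ⊆ P ∨ Metric.ball x r ∩ D ⊆ Q := fun x r hxr =>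
    isPreconnected_iff_subset_of_disjoint.1 ((convex_ball x r).inter hDc).isPreconnected P Q hP hQ
      ((Set.inter_subset_inter_left _ hxr).trans hPQ)
      (Set.subset_eq_empty (Set.inter_subset_inter_left _ (Set.inter_subset_inter_left _ hxr)) hne)
  have hcov : U ⊆ N P ∪ N Q := fun x hx => by
    obtain ⟨r, hr, hxr⟩ := hball x hx
    rcases hdich x r hxr with h | h
    · exact Or.inl (Set.mem_biUnion (x := (x, r)) ⟨hxr, h⟩ (Metric.mem_ball_self hr))
    · exact Or.inr (Set.mem_biUnion (x := (x, r)) ⟨hxr, h⟩ (Metric.mem_ball_self hr))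
  have hmem : ∀ P Q : Set F, U ∩ D ∩ (P ∩ Q) = ∅ → U ⊆ N P ∪ N Q → ∀ p ∈ U, p ∈ D → p ∈ P →
      p ∈ N P := by
    intro P Q hne hcov p hpU hpD hpP
    rcases hcov hpU with h | h
    · exact h
    · obtain ⟨z, hz, hpz⟩ := Set.mem_iUnion₂.1 h
      have : p ∈ U ∩ D ∩ (P ∩ Q) := ⟨⟨hpU, hpD⟩, hpP, hz.2 ⟨hpz, hpD⟩⟩
      rw [hne] at this
      exact this.elim
  obtain ⟨x, hxU, hxP, hxQ⟩ := hU (N P) (N Q) (hN P) (hN Q) hcov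
    ⟨p, hpU, hmem P Q hne hcov p hpU hpD hpP⟩
    ⟨q, hqU, hmem Q P (by rwa [Set.inter_comm Q P]) (by rwa [Set.union_comm]) q hqU hqD hqQ⟩
  obtain ⟨z, hz, hxz⟩ := Set.mem_iUnion₂.1 hxP
  obtain ⟨w, hw, hxw⟩ := Set.mem_iUnion₂.1 hxQ
  obtain ⟨d, ⟨hdz, hdw⟩, hdD⟩ := hD.inter_open_nonempty _
    (Metric.isOpen_ball.inter Metric.isOpen_ball) ⟨x, hxz, hxw⟩
  have : d ∈ U ∩ D ∩ (P ∩ Q) := ⟨⟨hz.1 hdz, hdD⟩, hz.2 ⟨hdz, hdD⟩, hw.2 ⟨hdw, hdD⟩⟩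
  rw [hne] at this
  exact this

theorem isConnected_preimage_of_isOpen {E : Type*} [TopologicalSpace E] {ψ : E → F}
    (hψ : IsInducing ψ) (hd : DenseRange ψ) (hc : Convex ℝ (Set.range ψ)) {U : Set F}
    (hUo : IsOpen U) (hU : IsConnected U) : IsConnected (ψ ⁻¹' U) := by
  refine ⟨?_, ?_⟩
  · obtain ⟨_, hy, x, rfl⟩ := hd.inter_open_nonempty U hUo hU.1
    exact ⟨x, hy⟩
  · rw [← hψ.isPreconnected_image, Set.image_preimage_eq_inter_range]
    exact IsPreconnected.inter_dense_convex hU.2 hUo hd hc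

/-- An arbitrary open set inducing `V` may be disconnected. Keeping only balls centred on the
connected image of `V` repairs this, as each ball meets that image. -/
theorem exists_isConnected_preimage_eq {E : Type*} [TopologicalSpace E] {ψ : E → F}
    (hψ : IsInducing ψ) {V : Set E} (hVo : IsOpen V) (hV : IsConnected V) :
    ∃ W : Set F, IsOpen W ∧ IsConnected W ∧ ψ ⁻¹' W = V := by
  obtain ⟨W₀, hW₀, rfl⟩ := hψ.isOpen_iff.1 hVo
  have hball : ∀ x : ψ ⁻¹' W₀, ∃ r > 0, Metric.ball (ψ x) r ⊆ W₀ := fun x =>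
    Metric.isOpen_iff.1 hW₀ _ x.2
  choose r hr hrW using hball
  have himg : ψ '' (ψ ⁻¹' W₀) ⊆ ⋃ x : ψ ⁻¹' W₀, Metric.ball (ψ x) (r x) := by
    rintro _ ⟨x, hx, rfl⟩
    exact Set.mem_iUnion.2 ⟨⟨x, hx⟩, Metric.mem_ball_self (hr _)⟩
  obtain ⟨x₀, hx₀⟩ := hV.1
  refine ⟨⋃ x : ψ ⁻¹' W₀, Metric.ball (ψ x) (r x), isOpen_iUnion fun _ => Metric.isOpen_ball,
    ⟨⟨ψ x₀, himg ⟨x₀, hx₀, rfl⟩⟩, ?_⟩, ?_⟩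
  · have hpre : IsPreconnected (ψ '' (ψ ⁻¹' W₀)) :=
      hV.2.image ψ hψ.continuous.continuousOn
    refine isPreconnected_of_forall (ψ x₀) fun y hy => ?_
    obtain ⟨x, hx⟩ := Set.mem_iUnion.1 hy
    refine ⟨ψ '' (ψ ⁻¹' W₀) ∪ Metric.ball (ψ x) (r x),
      Set.union_subset himg (Set.subset_iUnion (fun x : ψ ⁻¹' W₀ => Metric.ball (ψ x) (r x)) x),
      Or.inl ⟨x₀, hx₀, rfl⟩, Or.inr hx, ?_⟩
    exact hpre.union (ψ x) ⟨x, x.2, rfl⟩ (Metric.mem_ball_self (hr x))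
      (convex_ball _ _).isPreconnected
  · refine Set.Subset.antisymm (fun x hx => ?_) fun x hx => himg ⟨x, hx, rfl⟩
    obtain ⟨y, hy⟩ := Set.mem_iUnion.1 hx
    exact hrW y hy

theorem forall_isConnected_inter_preimage_iff {E : Type*} [TopologicalSpace E] {ψ : E → F}
    (hψ : IsInducing ψ) (hd : DenseRange ψ) (hc : Convex ℝ (Set.range ψ)) {G : Set F}
    (hG : IsOpen G) :
    (∀ V : Set E, IsOpen V → IsConnected V → IsConnected (V ∩ ψ ⁻¹' G)) ↔
      ∀ W : Set F, IsOpen W → IsConnected W → IsConnected (W ∩ G) := by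
  constructor
  · intro h W hWo hW
    have := (h _ (hWo.preimage hψ.continuous)
      (isConnected_preimage_of_isOpen hψ hd hc hWo hW)).image ψ hψ.continuous.continuousOn
    rw [← Set.preimage_inter, Set.image_preimage_eq_inter_range] at this
    -- `W ∩ G` lies between its connected trace on the range and the closure of that trace.
    exact this.subset_closure Set.inter_subset_left
      (hd.open_subset_closure_inter (hWo.inter hG))
  · intro h V hVo hV
    obtain ⟨W, hWo, hW, rfl⟩ := exists_isConnected_preimage_eq hψ hVo hV
    exact isConnected_preimage_of_isOpen hψ hd hc (hWo.inter hG) (h W hWo hW)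

end Connectedness

/-! ### Existence of an identity in A and in B. -/

section Identity

variable {B : Type*} [NonUnitalCStarAlgebra B]

theorem exists_isSelfAdjoint_dist_lt {A : NonUnitalStarSubalgebra ℂ B} (hdense : Dense (A : Set B))
    {b : B} (hb : IsSelfAdjoint b) {ε : ℝ} (hε : 0 < ε) :
    ∃ a ∈ A, IsSelfAdjoint a ∧ ‖a - b‖ < ε := by
  obtain ⟨a, ha, had⟩ := Metric.mem_closure_iff.1 (hdense b) ε hε
  rw [dist_comm, dist_eq_norm] at had
  refine ⟨(2⁻¹ : ℝ) • (a + star a), ?_, ?_, ?_⟩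
  · have : (2⁻¹ : ℝ) • (a + star a) = (2⁻¹ : ℂ) • (a + star a) := by
      rw [← Complex.coe_smul]; norm_num
    rw [this]
    exact SMulMemClass.smul_mem _ (add_mem ha (star_mem ha))
  · exact IsSelfAdjoint.smul (.all _) (IsSelfAdjoint.add_star_self a)
  · have : (2⁻¹ : ℝ) • (a + star a) - b = (2⁻¹ : ℝ) • ((a - b) + star (a - b)) := by
      rw [star_sub, hb.star_eq, show a - b + (star a - b) = (a + star a) - (2 : ℝ) • b by
        rw [two_smul]; abel, smul_sub, smul_smul]
      norm_num
    rw [this, norm_smul]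
    have h2 := norm_add_le (a - b) (star (a - b))
    rw [norm_star] at h2
    rw [Real.norm_of_nonneg (by norm_num)]
    linarith

theorem eq_zero_of_mul_self_of_norm_lt_one {q : B} (hq : q * q = q) (h : ‖q‖ < 1) : q = 0 := by
  by_contra hne
  have hpos : 0 < ‖q‖ := norm_pos_iff.2 hne
  have h1 := norm_mul_le q q
  rw [hq] at h1
  nlinarith

theorem isSelfAdjoint_of_identity {R : Type*} [NonUnitalRing R] [StarRing R] {e : R}
    (he : ∀ x : R, e * x = x ∧ x * e = x) : IsSelfAdjoint e := by
  have h := (IsSelfAdjoint.star_mul_self e)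
  rwa [(he (star e)).2, IsSelfAdjoint.star_iff] at h

/-- A dense smooth subalgebra contains the identity element of the algebra. -/
theorem identity_mem_of_dense {A : NonUnitalStarSubalgebra ℂ B} (hdense : Dense (A : Set B))
    (hsmooth : IsClosedUnderSmoothCalculus A) {e : B} (he : ∀ x : B, e * x = x ∧ x * e = x) :
    e ∈ A := by
  have hes := isSelfAdjoint_of_identity he
  obtain ⟨a, haA, has, hae⟩ := exists_isSelfAdjoint_dist_lt hdense hes (show (0 : ℝ) < 1 / 8 by
    norm_num)
  obtain ⟨g, hg, hg0, -, -, hg1⟩ := exists_contDiff_cutoff (show (0 : ℝ) < 1 / 2 by norm_num)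
  have hgc := hg.continuous
  set f : ℝ → ℝ := fun t => g (3 / 4 - t) with hf
  have hfs : ContDiff ℝ (⊤ : ℕ∞) f := hg.comp (contDiff_const.sub contDiff_id)
  have hfc := hfs.continuous
  have hf0 : ∀ t ≤ 1 / 4, f t = 0 := fun t ht => hg1 _ (by linarith)
  have hf1 : ∀ t, 3 / 4 ≤ t → f t = 1 := fun t ht => hg0 _ (by linarith)
  have hf00 : f 0 = 0 := hf0 0 (by norm_num)
  clear_value f
  -- `|t² - t| = 3/16` at `t = 1/4` and `t = 3/4`, so this bound opens a spectral gap exactly where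
  -- `f` passes from 0 to 1.
  have hsmall : ‖a * a - a‖ < 3 / 16 := by
    set d := a - e with hd
    have hda : a = e + d := by rw [hd]; abel
    have : a * a - a = d + d * d := by
      rw [hda, mul_add, add_mul, add_mul, (he e).1, (he d).1, (he d).2]; abel
    rw [this]
    have h1 := norm_add_le d (d * d)
    have h2 := norm_mul_le d d
    nlinarith [norm_nonneg d]
  have hspec : ∀ t ∈ quasispectrum ℝ a, t < 1 / 4 ∨ 3 / 4 < t ∧ t < 5 / 4 := fun t ht => by
    have h1 := norm_apply_le_norm_cfcₙ (fun t : ℝ => t * t - t) a ht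
    rw [cfcₙ_sub (fun t : ℝ => t * t) (fun t => t) a, cfcₙ_mul (fun t : ℝ => t) (fun t => t) a,
      cfcₙ_id' ℝ a] at h1
    have h2 := (abs_lt.1 (h1.trans_lt hsmall)).2
    by_contra! hcon
    rcases lt_or_ge (3 / 4) t with h3 | h3
    · nlinarith [hcon.2 h3]
    · have h4 := (abs_lt.1 (h1.trans_lt hsmall)).1
      nlinarith [hcon.1]
  have hspec' : ∀ t ∈ quasispectrum ℝ a, -1 / 4 < t := fun t ht => by
    have h1 := norm_apply_le_norm_cfcₙ (fun t : ℝ => t * t - t) a ht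
    rw [cfcₙ_sub (fun t : ℝ => t * t) (fun t => t) a, cfcₙ_mul (fun t : ℝ => t) (fun t => t) a,
      cfcₙ_id' ℝ a] at h1
    have h2 := (abs_lt.1 (h1.trans_lt hsmall)).2
    by_contra! hcon
    nlinarith
  have hp : cfcₙ f a * cfcₙ f a = cfcₙ f a := by
    rw [← cfcₙ_mul f f a]
    refine cfcₙ_congr fun t ht => ?_
    rcases hspec t ht with h | h
    · simp [hf0 t h.le]
    · simp [hf1 t h.1.le]
  have hpa : ‖cfcₙ f a - a‖ ≤ 1 / 4 := by
    nth_rw 2 [← cfcₙ_id' ℝ a]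
    rw [← cfcₙ_sub f (fun t => t) a]
    refine norm_cfcₙ_le fun t ht => ?_
    have h' := hspec' t ht
    rw [Real.norm_eq_abs, abs_le]
    rcases hspec t ht with h | h
    · rw [hf0 t h.le]; constructor <;> linarith
    · rw [hf1 t h.1.le]; constructor <;> linarith
  -- The difference is an idempotent of norm below `1/8 + 1/4 < 1`.
  have hq : e - cfcₙ f a = 0 := by
    refine eq_zero_of_mul_self_of_norm_lt_one ?_ ?_
    · rw [mul_sub, sub_mul, sub_mul, hp, (he e).1, (he _).1, (he _).2]; abel
    · have := norm_add_le (a - e) (cfcₙ f a - a)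
      rw [show a - e + (cfcₙ f a - a) = -(e - cfcₙ f a) by abel, norm_neg] at this
      linarith
  rw [sub_eq_zero.1 hq]
  exact hsmooth a haA has f hfs hf00

theorem identity_of_dense {A : NonUnitalStarSubalgebra ℂ B} (hdense : Dense (A : Set B)) {e : A}
    (he : ∀ x : A, e * x = x ∧ x * e = x) (x : B) : (e : B) * x = x ∧ x * (e : B) = x := by
  have h1 : IsClosed {x : B | (e : B) * x = x ∧ x * (e : B) = x} :=
    (isClosed_eq (by fun_prop) (by fun_prop)).inter (isClosed_eq (by fun_prop) (by fun_prop))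
  refine h1.closure_subset_iff.2 (fun y hy => ?_) (hdense x)
  exact ⟨congrArg Subtype.val (he ⟨y, hy⟩).1, congrArg Subtype.val (he ⟨y, hy⟩).2⟩

theorem hasIdentity_iff {A : NonUnitalStarSubalgebra ℂ B} (hdense : Dense (A : Set B))
    (hsmooth : IsClosedUnderSmoothCalculus A) : HasIdentity A ↔ HasIdentity B :=
  ⟨fun ⟨e, he⟩ => ⟨e, identity_of_dense hdense he⟩,
    fun ⟨e, he⟩ => ⟨⟨e, identity_mem_of_dense hdense hsmooth he⟩,
      fun x => ⟨Subtype.ext (he x).1, Subtype.ext (he x).2⟩⟩⟩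

end Identity

/-! ### Unimodularity over A and over B. -/

section Full

theorem isInvertible_iff_isUnit {S : Type*} [Ring S] {a : S} : IsInvertible a ↔ IsUnit a := by
  rw [isUnit_iff_exists]
  constructor
  · rintro ⟨e, b, he, h1, h2⟩
    have : e = 1 := by rw [← (he 1).1, mul_one]
    exact ⟨b, this ▸ h1, this ▸ h2⟩
  · rintro ⟨b, h1, h2⟩
    exact ⟨1, b, fun x => ⟨one_mul x, mul_one x⟩, h1, h2⟩

theorem mem_Lg_iff_comp {R T : Type*} [NonUnitalRing R] [NonUnitalRing T] [TopologicalSpace T]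
    [ContinuousAdd T] [ContinuousMul T] (φ : R →ₙ+* T) (hφ : DenseRange φ) {e : R}
    (he : ∀ x : R, e * x = x ∧ x * e = x) (he' : ∀ x : T, φ e * x = x ∧ x * φ e = x)
    (hfull : ∀ r, IsInvertible (φ r) → IsInvertible r)
    (hopen : {t : T | IsInvertible t} ∈ 𝓝 (φ e)) {n : ℕ} {a : Fin n → R} :
    a ∈ Lg R n ↔ φ ∘ a ∈ Lg T n := by
  rw [mem_Lg_iff_exists_eq he, mem_Lg_iff_exists_eq he']
  constructor
  · rintro ⟨c, hc⟩
    exact ⟨φ ∘ c, by rw [← hc, map_sum]; simp⟩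
  · rintro ⟨d, hd⟩
    have hcont : Continuous fun d : Fin n → T => ∑ i, d i * φ (a i) := by fun_prop
    have hnhds : {d : Fin n → T | IsInvertible (∑ i, d i * φ (a i))} ∈ 𝓝 d := by
      refine hcont.continuousAt.preimage_mem_nhds (t := {t : T | IsInvertible t}) ?_
      rwa [show ∑ i, d i * φ (a i) = φ e from hd]
    obtain ⟨_, hc, c, rfl⟩ :=
      mem_closure_iff_nhds.1 (DenseRange.piMap (fun _ : Fin n => hφ) d) _ hnhds
    have hc' : IsInvertible (φ (∑ i, c i * a i)) := by
      simpa [map_sum] using hc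
    obtain ⟨e', b, he2, -, hb⟩ := hfull _ hc'
    have hee : e' = e := by rw [← (he e').1, (he2 e).2]
    refine ⟨fun i => b * c i, ?_⟩
    simp only [mul_assoc, ← Finset.mul_sum, hb, hee]

variable {B : Type*} [NonUnitalCStarAlgebra B]

/-- The unitization splits as `B ⊕ ℂ(1 - e)`; cutting an inverse down by `e` gives one in `B`.
Openness of units in the unitization then passes to `B`. -/
theorem isInvertible_of_isUnit_unitization {e : B} (he : ∀ x : B, e * x = x ∧ x * e = x) {t : B}
    (ht : IsUnit ((t : Unitization ℂ B) + (1 - (e : Unitization ℂ B)))) : IsInvertible t := by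
  obtain ⟨y, h1, h2⟩ := isUnit_iff_exists.1 ht
  have hE : ∀ x : B, (e : Unitization ℂ B) * x = x ∧ (x : Unitization ℂ B) * e = x := fun x => by
    simp only [← Unitization.inr_mul, (he x).1, (he x).2, and_self]
  have h1' : (t : Unitization ℂ B) * y = e := by
    have := congrArg ((e : Unitization ℂ B) * ·) h1
    simpa [← mul_assoc, mul_add, mul_sub, (hE t).1, (hE e).1] using this
  have h2' : y * (t : Unitization ℂ B) = e := by
    have := congrArg (· * (e : Unitization ℂ B)) h2
    simpa [mul_assoc, add_mul, sub_mul, (hE t).2, (hE e).1] using this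
  have hb : y * (e : Unitization ℂ B) = ((y * (e : Unitization ℂ B)).snd : B) := by
    ext <;> simp
  set b := (y * (e : Unitization ℂ B)).snd
  refine ⟨e, b, he, ?_, ?_⟩
  · apply Unitization.inr_injective (R := ℂ)
    rw [Unitization.inr_mul, ← hb, ← mul_assoc, h1', (hE e).1]
  · apply Unitization.inr_injective (R := ℂ)
    rw [Unitization.inr_mul, ← hb, mul_assoc, (hE t).1, h2']

theorem isInvertible_mem_nhds {e : B} (he : ∀ x : B, e * x = x ∧ x * e = x) :
    {t : B | IsInvertible t} ∈ 𝓝 e := by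
  have hcont : Continuous fun t : B =>
      (t : Unitization ℂ B) + (1 - (e : Unitization ℂ B)) := by fun_prop
  refine mem_of_superset ((Units.isOpen.preimage hcont).mem_nhds ?_) fun t ht =>
    isInvertible_of_isUnit_unitization he ht
  change IsUnit _
  simp

theorem mem_Lg_iff_of_hasIdentity {A : NonUnitalStarSubalgebra ℂ B} (hdense : Dense (A : Set B))
    (hfull : IsFull A) (hid : HasIdentity A) {n : ℕ} {a : Fin n → A} :
    a ∈ Lg A n ↔ (fun i => (a i : B)) ∈ Lg B n := by
  have hf := hfull.1 hid
  obtain ⟨e, he⟩ := hid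
  exact mem_Lg_iff_comp ((NonUnitalStarSubalgebraClass.subtype A : A →ₙ+* B))
    hdense.denseRange_val he (identity_of_dense hdense he) hf
    (isInvertible_mem_nhds (identity_of_dense hdense he))

end Full

/-! ### Algebras with identity: reduction to the unitization. -/

section UnitalTransfer

variable {B : Type*} [NonUnitalCStarAlgebra B]

theorem identity_mul_inr {e : B} (he : ∀ x : B, e * x = x ∧ x * e = x) (x : B) :
    (e : Unitization ℂ B) * x = x ∧ (x : Unitization ℂ B) * e = x := by
  simp only [← Unitization.inr_mul, (he x).1, (he x).2, and_self]

/-- The tuple `a + (1 - e, 0, …, 0)` over the unitization, where `e` is the identity of `B`. -/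
def addComplement (e : B) {n : ℕ} (a : Fin n → B) (i : Fin n) : Unitization ℂ B :=
  a i + firstUnit (Unitization ℂ B) n i * (1 - (e : Unitization ℂ B))

/-- In the splitting `B ⊕ ℂ(1 - e)` the second component of the tuple is (1,0,…,0), which is always
unimodular since `n ≥ 1`. -/
theorem addComplement_mem_Lg_iff {e : B} (he : ∀ x : B, e * x = x ∧ x * e = x) {n : ℕ}
    (hn : 1 ≤ n) {a : Fin n → B} : addComplement e a ∈ Lg (Unitization ℂ B) n ↔ a ∈ Lg B n := by
  rw [mem_Lg_iff_exists_eq_one, mem_Lg_iff_exists_eq he]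
  have hE := identity_mul_inr he
  have hu : ∀ (i : Fin n) (s : Unitization ℂ B),
      s * firstUnit (Unitization ℂ B) n i = firstUnit (Unitization ℂ B) n i * s := fun i s => by
    unfold firstUnit; split_ifs <;> simp
  constructor
  · rintro ⟨c, hc⟩
    have hb : ∀ i, (e : Unitization ℂ B) * c i = (((e : Unitization ℂ B) * c i).snd : B) :=
      fun i => by ext <;> simp
    refine ⟨fun i => ((e : Unitization ℂ B) * c i).snd, ?_⟩
    apply Unitization.inr_injective (R := ℂ)
    have h := congrArg (fun x : Unitization ℂ B => (e : Unitization ℂ B) * x * e) hc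
    have hi : ∀ i, addComplement e a i * (e : Unitization ℂ B) = a i := fun i => by
      rw [addComplement, add_mul, mul_assoc, sub_mul, (hE e).1, (hE _).2, one_mul, sub_self,
        mul_zero, add_zero]
    simp only [Finset.mul_sum, Finset.sum_mul, mul_assoc, hi, one_mul, (hE e).1] at h
    refine Eq.trans ?_ h
    change Unitization.inrNonUnitalAlgHom ℂ B _ = _
    rw [map_sum]
    refine Finset.sum_congr rfl fun i _ => ?_
    rw [map_mul]
    change ((((e : Unitization ℂ B) * c i).snd : B) : Unitization ℂ B) * (a i) = _
    rw [← hb, mul_assoc]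
  · rintro ⟨c, hc⟩
    refine ⟨addComplement e c, ?_⟩
    have hi : ∀ i, addComplement e c i * addComplement e a i = ((c i * a i : B) : Unitization ℂ B)
        + firstUnit (Unitization ℂ B) n i * (1 - (e : Unitization ℂ B)) := fun i => by
      have h1 : (1 - (e : Unitization ℂ B)) * (a i : Unitization ℂ B) = 0 := by
        rw [sub_mul, one_mul, (hE _).1, sub_self]
      have h2 : (c i : Unitization ℂ B) * (1 - (e : Unitization ℂ B)) = 0 := by
        rw [mul_sub, mul_one, (hE _).2, sub_self]
      have h3 : (1 - (e : Unitization ℂ B)) * (1 - (e : Unitization ℂ B)) =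
          1 - (e : Unitization ℂ B) := by
        rw [sub_mul, mul_sub, mul_sub, (hE e).1]; simp
      simp only [addComplement, firstUnit]
      split_ifs
      · simp [add_mul, mul_add, h1, h2, h3]
      · simp
    simp only [hi, Finset.sum_add_distrib, ← Finset.sum_mul, sum_firstUnit hn, one_mul]
    have : ∑ i, ((c i * a i : B) : Unitization ℂ B) = e := by
      rw [← hc]
      exact (map_sum (Unitization.inrNonUnitalAlgHom ℂ B) _ _).symm
    rw [this]
    abel

theorem isOpen_Lg_of_identity {e : B} (he : ∀ x : B, e * x = x ∧ x * e = x) {n : ℕ} (hn : 1 ≤ n) :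
    IsOpen (Lg B n) := by
  have hcont : Continuous fun a : Fin n → B => addComplement e a := by
    unfold addComplement
    fun_prop
  convert (isOpen_Lg (Unitization ℂ B) n).preimage hcont using 1
  ext a
  exact (addComplement_mem_Lg_iff he hn).symm

variable {R : Type*} [NonUnitalRing R]

/-- `addComplement` identifies tuples over `R` with those congruent to (1,0,…,0), and a correction
leaves the added `1 - e` untouched because it sits in the first slot, not the last. Using the
inclusion of A and the identity of B as `φ` places both algebras in one unitization. -/
theorem bassCondition_iff_mod (φ : R →ₙ+* B) {e : R}
    (he : ∀ x : B, φ e * x = x ∧ x * φ e = x)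
    (hLg : ∀ {n : ℕ} {a : Fin n → R}, a ∈ Lg R n ↔ φ ∘ a ∈ Lg B n) {n : ℕ} (hn : 1 ≤ n) :
    BassCondition R n ↔
      BassConditionMod (Set.range fun x : R => (φ x : Unitization ℂ B)) n := by
  have hE := identity_mul_inr he
  have key : ∀ (a : Fin (n + 1) → R) (c : Fin n → R),
      addComplement (φ e) (φ ∘ fun i => a i.castSucc + c i * a (Fin.last n)) =
      fun i => addComplement (φ e) (φ ∘ a) i.castSucc +
        (φ (c i) : Unitization ℂ B) * addComplement (φ e) (φ ∘ a) (Fin.last n) := by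
    intro a c
    funext i
    simp [addComplement, firstUnit, show n ≠ 0 by omega]
    abel
  constructor
  · rintro h b ⟨hb, hbX⟩
    choose x hx using hbX
    obtain ⟨a, rfl⟩ : ∃ a : Fin (n + 1) → R, b = addComplement (φ e) (φ ∘ a) := by
      refine ⟨fun i => x i + if (i : ℕ) = 0 then e else 0, funext fun i => ?_⟩
      rw [← sub_eq_iff_eq_add.1 (hx i).symm |>.symm]
      simp only [addComplement, firstUnit, Function.comp]
      split_ifs <;> simp
    rw [addComplement_mem_Lg_iff he (by omega), ← hLg] at hb
    obtain ⟨c, hc⟩ := h _ hb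
    refine ⟨fun i => φ (c i), fun i => ⟨c i, rfl⟩, ?_⟩
    rw [hLg, ← addComplement_mem_Lg_iff he hn, key] at hc
    exact hc
  · intro h a ha
    rw [hLg, ← addComplement_mem_Lg_iff he (by omega)] at ha
    have haX : addComplement (φ e) (φ ∘ a) ∈
        tuplesMod (Set.range fun x : R => (φ x : Unitization ℂ B)) (n + 1) := fun i => by
      refine ⟨a i - if (i : ℕ) = 0 then e else 0, ?_⟩
      simp only [addComplement, firstUnit, Function.comp]
      split_ifs
      · simp only [map_sub, Unitization.inr_sub, one_mul]
        abel
      · simp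
    obtain ⟨c, hc, hL⟩ := h _ ⟨ha, haX⟩
    choose c' hc' using hc
    refine ⟨c', ?_⟩
    rw [hLg, ← addComplement_mem_Lg_iff he hn, key]
    simpa only [hc'] using hL

end UnitalTransfer

/-! ### Algebras without identity: reduction to the unitization of B. -/

section NonunitalTransfer

variable {B : Type*} [NonUnitalCStarAlgebra B]
variable {R : Type*} [NonUnitalRing R] [StarRing R] [Module ℂ R] [IsScalarTower ℂ R R]
  [SMulCommClass ℂ R R]

theorem mem_affineTuples_iff (φ : R →⋆ₙₐ[ℂ] B) {n : ℕ} {a : Fin n → Unitization ℂ R} :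
    a ∈ affineTuples R n ↔ Unitization.starMap φ ∘ a ∈
      tuplesMod (Set.range fun x : R => (φ x : Unitization ℂ B)) n := by
  refine forall_congr' fun i => ⟨fun h => ⟨(a i).snd, ?_⟩, ?_⟩
  · simp only [Function.comp, Unitization.starMap_apply, firstUnit]
    change _ = algebraMap ℂ _ (a i).fst + ((φ (a i).snd : B) : Unitization ℂ B) - _
    rw [h]
    split_ifs <;> simp
  · rintro ⟨x, hx⟩
    have h := congrArg (fun z : Unitization ℂ B => z.fst) hx
    simp only [Function.comp, Unitization.starMap_apply, firstUnit] at h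
    change (0 : ℂ) = (algebraMap ℂ (Unitization ℂ B) (a i).fst +
      ((φ (a i).snd : B) : Unitization ℂ B) - _).fst at h
    rw [Unitization.algebraMap_eq_inl] at h
    split_ifs at h ⊢ with hi
    · change (0 : ℂ) = (a i).fst + 0 - 1 at h
      rwa [add_zero, eq_comm, sub_eq_zero] at h
    · change (0 : ℂ) = (a i).fst + 0 - 0 at h
      rw [h, add_zero, sub_zero]

theorem relBassCondition_iff_mod (φ : R →⋆ₙₐ[ℂ] B)
    (hLg : ∀ {n : ℕ} {a : Fin n → Unitization ℂ R},
      a ∈ Lg (Unitization ℂ R) n ↔ Unitization.starMap φ ∘ a ∈ Lg (Unitization ℂ B) n)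
    {n : ℕ} (hn : 1 ≤ n) :
    RelBassCondition R n ↔
      BassConditionMod (Set.range fun x : R => (φ x : Unitization ℂ B)) n := by
  have key : ∀ (a : Fin (n + 1) → Unitization ℂ R) (c : Fin n → R),
      (Unitization.starMap φ ∘ fun i : Fin n =>
        a i.castSucc + (c i : Unitization ℂ R) * a (Fin.last n)) =
      fun i => (Unitization.starMap φ ∘ a) i.castSucc +
        (φ (c i) : Unitization ℂ B) * (Unitization.starMap φ ∘ a) (Fin.last n) := by
    intro a c
    funext i
    simp only [Function.comp, map_add, map_mul, Unitization.starMap_inr]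
  constructor
  · rintro h b ⟨hb, hbX⟩
    choose x hx using id hbX
    obtain ⟨a, rfl⟩ : ∃ a : Fin (n + 1) → Unitization ℂ R, b = Unitization.starMap φ ∘ a := by
      refine ⟨fun i => (x i : Unitization ℂ R) + if (i : ℕ) = 0 then 1 else 0,
        funext fun i => ?_⟩
      rw [← sub_eq_iff_eq_add.1 (hx i).symm |>.symm]
      simp only [firstUnit, Function.comp, map_add, Unitization.starMap_inr]
      split_ifs <;> simp
    obtain ⟨c, hc⟩ := h _ ⟨hLg.2 hb, (mem_affineTuples_iff φ).2 hbX⟩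
    refine ⟨fun i => φ (c i), fun i => ⟨c i, rfl⟩, ?_⟩
    have := hLg.1 hc.1
    rwa [key] at this
  · rintro h a ⟨haL, haA⟩
    obtain ⟨c, hc, hL⟩ := h _ ⟨hLg.1 haL, (mem_affineTuples_iff φ).1 haA⟩
    choose c' hc' using hc
    refine ⟨c', hLg.2 ?_, fun i => ?_⟩
    · rw [key]
      simpa only [hc'] using hL
    · have h1 := haA i.castSucc
      have h2 := haA (Fin.last n)
      simp only [Fin.val_castSucc] at h1
      simp only [Fin.val_last, show n ≠ 0 by omega, if_false] at h2
      simp [h1, h2]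

end NonunitalTransfer

theorem leastPositive_congr {P Q : ℕ → Prop} (h : ∀ n, 1 ≤ n → (P n ↔ Q n)) :
    leastPositive P = leastPositive Q := by
  unfold leastPositive
  refine iInf_congr fun n => iInf_congr_Prop ?_ fun _ => rfl
  exact and_congr_right fun hn => h n hn

/-! ### The three ranks of a dense, full, smooth subalgebra. -/

section Subalgebra

variable {B : Type*} [NonUnitalCStarAlgebra B] {A : NonUnitalStarSubalgebra ℂ B}

theorem bassConditionMod_range_iff (hdense : Dense (A : Set B))
    (hsmooth : IsClosedUnderSmoothCalculus A) {n : ℕ} (hn : 1 ≤ n) :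
    BassConditionMod (Set.range fun x : A => ((x : B) : Unitization ℂ B)) n ↔
      BassConditionMod (Set.range fun x : B => (x : Unitization ℂ B)) n := by
  have hAset : (Set.range fun x : A => ((x : B) : Unitization ℂ B)) =
      (A.map (Unitization.inrNonUnitalStarAlgHom ℂ B) : Set (Unitization ℂ B)) := by
    ext z
    simp
  have hJset : (Set.range fun x : B => (x : Unitization ℂ B)) =
      (NonUnitalStarAlgHom.range (Unitization.inrNonUnitalStarAlgHom ℂ B) :
        Set (Unitization ℂ B)) := by
    ext z
    simp
  rw [hAset, hJset]
  refine bassConditionMod_iff ?_ ?_ ?_ ?_ hn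
  · rintro _ ⟨k, hk, rfl⟩ hks f hf hf0
    have hks' : IsSelfAdjoint k := Unitization.isSelfAdjoint_inr.1 hks
    refine ⟨cfcₙ f k, hsmooth k hk hks' f hf hf0, ?_⟩
    -- Because `f 0 = 0`, the unital calculus in the unitization stays inside the image of B.
    exact Unitization.real_cfcₙ_eq_cfc_inr k f hf0
  · rintro s _ ⟨x, rfl⟩
    refine ⟨(s * (x : Unitization ℂ B)).snd, ?_⟩
    change (((s * (x : Unitization ℂ B)).snd : B) : Unitization ℂ B) = s * (x : Unitization ℂ B)
    ext <;> simp
  · rw [← hAset, ← hJset]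
    rintro _ ⟨x, rfl⟩
    exact ⟨x, rfl⟩
  · rw [← hAset, ← hJset]
    rintro _ ⟨x, rfl⟩
    have := image_closure_subset_closure_image
      (Unitization.continuous_inr (𝕜 := ℂ) (A := B)) ⟨x, hdense x, rfl⟩
    refine closure_mono ?_ this
    rintro _ ⟨y, hy, rfl⟩
    exact ⟨⟨y, hy⟩, rfl⟩

theorem range_starMap_subtype :
    Set.range (Unitization.starMap (NonUnitalStarSubalgebraClass.subtype A)) =
      (fun z : Unitization ℂ B => z.snd) ⁻¹' (A : Set B) := by
  ext z
  constructor
  · rintro ⟨w, rfl⟩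
    change 0 + (w.snd : B) ∈ A
    rw [zero_add]
    exact w.snd.2
  · intro hz
    refine ⟨Unitization.inl z.fst + ((⟨z.snd, hz⟩ : A) : Unitization ℂ A), ?_⟩
    simp only [map_add, Unitization.starMap_inl, Unitization.starMap_inr,
      Unitization.algebraMap_eq_inl]
    exact z.inl_fst_add_inr_snd_eq

theorem isInducing_coe : IsInducing ((↑) : A → B) := ⟨rfl⟩

theorem isInducing_starMap_subtype :
    let _ : TopologicalSpace (Unitization ℂ A) := unitizationTopology A
    IsInducing (Unitization.starMap (NonUnitalStarSubalgebraClass.subtype A)) := by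
  let _ : TopologicalSpace (Unitization ℂ A) := unitizationTopology A
  have h1 : IsInducing (fun z : Unitization ℂ A => (z.fst, z.snd)) := ⟨rfl⟩
  -- The topology of the C*-norm on the unitization is definitionally the product topology.
  have h2 : IsInducing (fun z : Unitization ℂ B => (z.fst, z.snd)) := ⟨rfl⟩
  have h3 : IsInducing (Prod.map id ((↑) : A → B) : ℂ × A → ℂ × B) :=
    IsInducing.id.prodMap IsInducing.subtypeVal
  have h4 := h3.comp h1
  rw [← h2.of_comp_iff]
  convert h4 using 1
  funext z
  refine Prod.ext ?_ ?_
  · change z.fst + 0 = z.fst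
    rw [add_zero]
  · change 0 + (z.snd : B) = (z.snd : B)
    rw [zero_add]

theorem denseRange_starMap_subtype (hdense : Dense (A : Set B)) :
    DenseRange (Unitization.starMap (NonUnitalStarSubalgebraClass.subtype A)) := by
  rw [DenseRange, range_starMap_subtype]
  refine hdense.preimage ?_
  exact isOpenMap_snd.comp
    (Unitization.uniformEquivProd (𝕜 := ℂ) (A := B)).toHomeomorph.isOpenMap

theorem convex_range_starMap_subtype :
    Convex ℝ (Set.range (Unitization.starMap (NonUnitalStarSubalgebraClass.subtype A))) := by
  rw [range_starMap_subtype]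
  intro x hx y hy s t _ _ _
  change (s • x + t • y).snd ∈ A
  have : (s • x + t • y).snd = (s : ℂ) • x.snd + (t : ℂ) • y.snd := rfl
  rw [this]
  exact add_mem (SMulMemClass.smul_mem _ hx) (SMulMemClass.smul_mem _ hy)

theorem mem_Lg_iff_of_not_hasIdentity (hdense : Dense (A : Set B)) (hfull : IsFull A)
    (hid : ¬ HasIdentity A) {n : ℕ} {a : Fin n → Unitization ℂ A} :
    a ∈ Lg (Unitization ℂ A) n ↔
      Unitization.starMap (NonUnitalStarSubalgebraClass.subtype A) ∘ a ∈
        Lg (Unitization ℂ B) n := by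
  have hf := hfull.2 hid
  have hone := map_one (Unitization.starMap (NonUnitalStarSubalgebraClass.subtype A))
  refine mem_Lg_iff_comp (e := (1 : Unitization ℂ A))
    (Unitization.starMap (NonUnitalStarSubalgebraClass.subtype A) :
      Unitization ℂ A →ₙ+* Unitization ℂ B)
    (denseRange_starMap_subtype hdense) (fun x => ⟨one_mul x, mul_one x⟩) ?_ ?_ ?_
  · intro x
    exact ⟨(congrArg (· * x) hone).trans (one_mul x), (congrArg (x * ·) hone).trans (mul_one x)⟩
  · intro z hz
    exact isInvertible_iff_isUnit.2 (hf z (isInvertible_iff_isUnit.1 hz))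
  · have : {t : Unitization ℂ B | IsInvertible t} = {t | IsUnit t} := by
      ext t
      exact isInvertible_iff_isUnit
    rw [this]
    exact Units.isOpen.mem_nhds (hone.symm ▸ isUnit_one)

theorem convex_coe_subalgebra : Convex ℝ (A : Set B) := by
  intro x hx y hy s t _ _ _
  have : s • x + t • y = (s : ℂ) • x + (t : ℂ) • y := rfl
  rw [this]
  exact add_mem (SMulMemClass.smul_mem _ hx) (SMulMemClass.smul_mem _ hy)

theorem bsr_eq (hdense : Dense (A : Set B)) (hfull : IsFull A)
    (hsmooth : IsClosedUnderSmoothCalculus A) : Bsr A = Bsr B := by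
  have hiff := hasIdentity_iff hdense hsmooth
  by_cases hid : HasIdentity A
  · rw [Bsr, Bsr, if_pos hid, if_pos (hiff.1 hid)]
    refine leastPositive_congr fun n hn => ?_
    obtain ⟨e, he⟩ := id hid
    have he' := identity_of_dense hdense he
    have h1 := bassCondition_iff_mod (NonUnitalStarSubalgebraClass.subtype A : A →ₙ+* B) he'
      (mem_Lg_iff_of_hasIdentity hdense hfull hid) hn
    have h2 := bassCondition_iff_mod (NonUnitalRingHom.id B) (e := (e : B)) he' Iff.rfl hn
    exact h1.trans ((bassConditionMod_range_iff hdense hsmooth hn).trans h2.symm)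
  · rw [Bsr, Bsr, if_neg hid, if_neg (hiff.not.1 hid)]
    refine leastPositive_congr fun n hn => ?_
    have h1 := relBassCondition_iff_mod (NonUnitalStarSubalgebraClass.subtype A)
      (mem_Lg_iff_of_not_hasIdentity hdense hfull hid) hn
    have h2 := relBassCondition_iff_mod (NonUnitalStarAlgHom.id ℂ B)
      (by intro n a; rw [Unitization.starMap_id]; exact Iff.rfl) hn
    exact h1.trans ((bassConditionMod_range_iff hdense hsmooth hn).trans h2.symm)

theorem preimage_Lg_of_hasIdentity (hdense : Dense (A : Set B)) (hfull : IsFull A)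
    (hid : HasIdentity A) (n : ℕ) :
    Lg A n = (Pi.map fun _ => ((↑) : A → B)) ⁻¹' Lg B n :=
  Set.ext fun _ => mem_Lg_iff_of_hasIdentity hdense hfull hid

theorem preimage_Lg_of_not_hasIdentity (hdense : Dense (A : Set B)) (hfull : IsFull A)
    (hid : ¬ HasIdentity A) (n : ℕ) : Lg (Unitization ℂ A) n =
      (Pi.map fun _ => Unitization.starMap (NonUnitalStarSubalgebraClass.subtype A)) ⁻¹'
        Lg (Unitization ℂ B) n :=
  Set.ext fun _ => mem_Lg_iff_of_not_hasIdentity hdense hfull hid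

theorem preimage_affineTuples (n : ℕ) : affineTuples A n =
    (Pi.map fun _ => Unitization.starMap (NonUnitalStarSubalgebraClass.subtype A)) ⁻¹'
      affineTuples B n := by
  ext a
  refine forall_congr' fun i => ?_
  change (a i).fst = _ ↔ (a i).fst + 0 = _
  rw [add_zero]

theorem affineTuples_subset_closure (hdense : Dense (A : Set B)) (n : ℕ) :
    affineTuples B n ⊆ closure (affineTuples B n ∩ Set.range (Pi.map fun _ =>
      Unitization.starMap (NonUnitalStarSubalgebraClass.subtype A))) := by
  intro b hb
  -- Scalar parts are frozen and only the components in B are perturbed, so approximants remain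
  -- affine tuples.
  let ψ : (Fin n → B) → Fin n → Unitization ℂ B := fun x i =>
    (Unitization.inl (b i).fst + (x i : Unitization ℂ B) : Unitization ℂ B)
  have hψ : Continuous ψ := by
    unfold ψ
    fun_prop
  have hd : Dense (Set.univ.pi fun _ : Fin n => (A : Set B)) :=
    dense_pi Set.univ fun _ _ => hdense
  have hbψ : b = ψ fun i => (b i).snd := funext fun i => (b i).inl_fst_add_inr_snd_eq.symm
  have := image_closure_subset_closure_image hψ ⟨fun i => (b i).snd, hd _, rfl⟩
  rw [← hbψ] at this
  refine closure_mono ?_ this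
  rintro _ ⟨x, hx, rfl⟩
  refine ⟨fun i => ?_, ?_⟩
  · change (b i).fst + 0 = _
    rw [add_zero, hb i]
  · rw [Set.range_piMap]
    intro i _
    rw [range_starMap_subtype]
    change 0 + x i ∈ A
    rw [zero_add]
    exact hx i trivial

theorem tsr_eq (hdense : Dense (A : Set B)) (hfull : IsFull A)
    (hsmooth : IsClosedUnderSmoothCalculus A) :
    @tsr A _ _ _ _ instTopologicalSpaceSubtype = tsr B := by
  have hiff := hasIdentity_iff hdense hsmooth
  by_cases hid : HasIdentity A
  · rw [tsr, tsr, if_pos hid, if_pos (hiff.1 hid)]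
    refine leastPositive_congr fun n hn => ?_
    obtain ⟨e, he⟩ := hiff.1 hid
    have hd : DenseRange (Pi.map fun _ : Fin n => ((↑) : A → B)) :=
      DenseRange.piMap fun _ => hdense.denseRange_val
    have := subset_closure_preimage_iff (P := Set.univ)
      (IsInducing.piMap fun _ : Fin n => isInducing_coe (A := A))
      (by rw [Set.univ_inter]; exact fun x _ => hd x) (isOpen_Lg_of_identity he hn)
    rw [preimage_Lg_of_hasIdentity hdense hfull hid]
    rw [Set.inter_univ, Set.preimage_univ, Set.univ_subset_iff, Set.univ_subset_iff,
      ← dense_iff_closure_eq, ← dense_iff_closure_eq] at this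
    exact this
  · rw [tsr, tsr, if_neg hid, if_neg (hiff.not.1 hid)]
    refine leastPositive_congr fun n hn => ?_
    let _ : TopologicalSpace (Unitization ℂ A) := unitizationTopology A
    have := subset_closure_preimage_iff
      (IsInducing.piMap fun _ : Fin n => isInducing_starMap_subtype (A := A))
      (affineTuples_subset_closure hdense n) (isOpen_Lg (Unitization ℂ B) n)
    rw [Set.preimage_inter, ← preimage_affineTuples,
      ← preimage_Lg_of_not_hasIdentity hdense hfull hid] at this
    exact this

theorem acsr_eq (hdense : Dense (A : Set B)) (hfull : IsFull A)
    (hsmooth : IsClosedUnderSmoothCalculus A) :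
    @acsr A _ _ _ _ instTopologicalSpaceSubtype = acsr B := by
  have hiff := hasIdentity_iff hdense hsmooth
  by_cases hid : HasIdentity A
  · rw [acsr, acsr, if_pos hid, if_pos (hiff.1 hid)]
    refine leastPositive_congr fun n hn => forall₂_congr fun m hm => ?_
    obtain ⟨e, he⟩ := hiff.1 hid
    rw [InAcsRange, preimage_Lg_of_hasIdentity hdense hfull hid]
    refine forall_isConnected_inter_preimage_iff
      (IsInducing.piMap fun _ : Fin m => isInducing_coe (A := A))
      (DenseRange.piMap fun _ => hdense.denseRange_val) ?_
      (isOpen_Lg_of_identity he (hn.trans hm))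
    rw [Set.range_piMap]
    refine convex_pi fun i _ => ?_
    rw [Subtype.range_coe_subtype]
    exact convex_coe_subalgebra
  · rw [acsr, acsr, if_neg hid, if_neg (hiff.not.1 hid)]
    refine leastPositive_congr fun n hn => forall₂_congr fun m hm => ?_
    let _ : TopologicalSpace (Unitization ℂ A) := unitizationTopology A
    rw [InAcsRange, preimage_Lg_of_not_hasIdentity hdense hfull hid]
    refine forall_isConnected_inter_preimage_iff
      (IsInducing.piMap fun _ : Fin m => isInducing_starMap_subtype (A := A))
      (DenseRange.piMap fun _ => denseRange_starMap_subtype hdense) ?_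
      (isOpen_Lg (Unitization ℂ B) m)
    rw [Set.range_piMap]
    exact convex_pi fun i _ => convex_range_starMap_subtype

end Subalgebra
end StableRank

theorem mainTheorem2 {B : Type*} [NonUnitalCStarAlgebra B] (A : NonUnitalStarSubalgebra ℂ B)
    (τ : TopologicalSpace A) (hτ : StableRank.IsFrechetAlgebra τ)
    (hdense : Dense (A : Set B)) (hfull : StableRank.IsFull A)
    (hsmooth : StableRank.IsClosedUnderSmoothCalculus A) :
    StableRank.Bsr A = StableRank.Bsr B ∧
    @StableRank.tsr A _ _ _ _ (instTopologicalSpaceSubtype) = StableRank.tsr B ∧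
    (StableRank.IsNormedAlgebraTopology τ →
      @StableRank.acsr A _ _ _ _ (instTopologicalSpaceSubtype) = StableRank.acsr B) :=
  ⟨StableRank.bsr_eq hdense hfull hsmooth, StableRank.tsr_eq hdense hfull hsmooth,
    fun _ => StableRank.acsr_eq hdense hfull hsmooth⟩
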